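/- For $0<\alpha\le\pi/2$ let $S_\alpha=\{z\in\mathbb C:\operatorname{Re}z>0,\ |\arg z|<\alpha\}$, and let $H(S_\alpha)$ be the Fréchet space of holomorphic functions on $S_\alpha$ with the topology of local uniform convergence, $H(S_\alpha)'$ its dual. The spectral radius of an element $b$ of a (not necessarily unital) complex Banach algebra is denoted by $\rho(b)$, and $\operatorname{rad}\mathcal A=\{a\in\mathcal A:\rho(a)=0\}$ for a commutative Banach algebra $\mathcal A$. **Theorem.** Let $0\le\beta<\alpha<\pi/2$. Let $\phi\in H(S_\alpha)'$ be induced by a complex Borel measure $\mu$ with compact support contained in $\{\xi\in S_\alpha:|\arg\xi|\le\beta\}$, that is, $\langle g,\phi\rangle=\int_{S_\alpha}g\,d\mu$ for all $g\in H(S_\alpha)$. Suppose that $\mu$ is symmetric, i.e. $\mu(\overline S)=\overline{\mu(S)}$ for all Borel sets $S\subseteq S_\alpha$, and that $\mu(S_\alpha)=0$. Let $f(z)=\langle e^{-z\,\cdot},\phi\rangle=\int_{S_\alpha}e^{-z\xi}\,d\mu(\xi)$ $(z\in\mathbb C)$ be the Fourier–Borel transform of $\phi$. Let $(T(t))_{t\in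 S_\alpha}$ be an analytic semigroup in a complex Banach algebra $B$ (i.e. $T:S_\alpha\to B$ is complex-differentiable in norm and $T(s+t)=T(s)T(t)$ for all $s,t\in S_\alpha$) which is not quasinilpotent (i.e. $\rho(T(t))\neq0$ for some $t\in S_\alpha$). Let $\mathcal A$ be the closed subalgebra of $B$ generated by $\{T(t):t\in S_\alpha\}$ (it is commutative), and $\pi:\mathcal A\to\mathcal A/\operatorname{rad}\mathcal A$ the canonical surjection. For $t\in S_{\alpha-\beta}$ put $$f(-tA)=\int_{S_\alpha}T(t\xi)\,d\mu(\xi),$$ a Bochner integral, which is defined because $t\xi\in S_\alpha$ for every $\xi$ in the support of $\mu$. If there exists $t_0>0$ such that $$\sup_{t\in S_{\alpha-\beta},\ |t|\le t_0}\rho\bigl(f(-tA)\bigr)<\sup_{z\in S_{\alpha-\beta}}|f(z)|,$$ then $\mathcal A/\operatorname{rad}\mathcal A$ is unital, and the semigroup $(\pi(T(t)))_{t\in S_\alpha}$ has a bounded generator: there is $u\in\mathcal A/\operatorname{rad}\mathcal A$ such that $\pi(T(t))=\exp(tu)$ for all $t\in S_\alpha$. -/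

import Mathlib

open MeasureTheory
open scoped ENNReal NNReal ComplexConjugate

noncomputable section

/-- The open sector `S_α = {z : Re z > 0, |arg z| < α}`. -/
def sector (α : ℝ) : Set ℂ := {z | 0 < z.re ∧ |z.arg| < α}

/-! ### Complex measures -/

/-- The (Bochner) integral of a vector-valued function against a complex measure `μ`, by means of
the Jordan decompositions of the real and the imaginary part of `μ`. -/
def cintegral {X E : Type*} [MeasurableSpace X] [NormedAddCommGroup E] [NormedSpace ℂ E]
    (μ : ComplexMeasure X) (g : X → E) : E :=
  ((∫ x, g x ∂(ComplexMeasure.re μ).toJordanDecomposition.posPart)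
      - ∫ x, g x ∂(ComplexMeasure.re μ).toJordanDecomposition.negPart)
    + Complex.I •
      ((∫ x, g x ∂(ComplexMeasure.im μ).toJordanDecomposition.posPart)
        - ∫ x, g x ∂(ComplexMeasure.im μ).toJordanDecomposition.negPart)

/-- The complex measure `μ` is carried by the set `K`. -/
def CarriedBy {X : Type*} [MeasurableSpace X] (μ : ComplexMeasure X) (K : Set X) : Prop :=
  ∀ S : Set X, MeasurableSet S → Disjoint S K → μ S = 0

/-- `μ ∈ M_c(X)`: the complex Borel measure `μ` on `X` has compact support. -/
def HasCompactSupp {X : Type*} [TopologicalSpace X] [MeasurableSpace X]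
    (μ : ComplexMeasure X) : Prop :=
  ∃ K : Set X, IsCompact K ∧ CarriedBy μ K

theorem conj_mem_sector {α : ℝ} {z : ℂ} (hz : z ∈ sector α) : conj z ∈ sector α := by
  refine ⟨by simpa using hz.1, ?_⟩
  have h : z.arg ≠ Real.pi := by
    intro h
    have := (Complex.arg_eq_pi_iff.1 h).1
    linarith [hz.1]
  rw [Complex.arg_conj, if_neg h, abs_neg]
  exact hz.2

/-- Complex conjugation as a map of the sector to itself. -/
def sectorConj (α : ℝ) (ξ : sector α) : sector α := ⟨conj (ξ : ℂ), conj_mem_sector ξ.2⟩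

/-- A complex Borel measure on the sector is symmetric if `μ (conj S) = conj (μ S)`. -/
def IsSymmetricMeasure {α : ℝ} (μ : ComplexMeasure (sector α)) : Prop :=
  ∀ S : Set (sector α), MeasurableSet S → μ (sectorConj α '' S) = conj (μ S)

/-! ### Holomorphic functions on the sector, analytic functionals, Fourier-Borel transform -/

/-- The space `H(S_α)` of holomorphic functions on the sector, with the topology of locally uniform
convergence (the compact-open topology induced from the space of continuous functions). -/
def holomorphicOnSector (α : ℝ) : Submodule ℂ C(sector α, ℂ) where
  carrier := {g | ∃ G : ℂ → ℂ, DifferentiableOn ℂ G (sector α) ∧ ∀ ξ : sector α, g ξ = G ξ}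
  add_mem' := by
    rintro g h ⟨G, hG, hg⟩ ⟨H, hH, hh⟩
    exact ⟨G + H, hG.add hH, fun ξ => by simp [hg, hh]⟩
  zero_mem' := ⟨0, differentiableOn_const 0, fun ξ => rfl⟩
  smul_mem' := by
    rintro c g ⟨G, hG, hg⟩
    exact ⟨c • G, hG.const_smul c, fun ξ => by simp [hg]⟩

/-- The exponential `e_{-z} : ξ ↦ exp (-z ξ)` as an element of `H(S_α)`. -/
def expNeg (α : ℝ) (z : ℂ) : holomorphicOnSector α :=
  ⟨⟨fun ξ => Complex.exp (-z * ξ), by fun_prop⟩,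
    fun ξ => Complex.exp (-z * ξ), by fun_prop, fun _ => rfl⟩

/-- The Fourier-Borel transform `z ↦ ⟨e_{-z}, φ⟩` of `φ ∈ H(S_α)'`. -/
def fourierBorel {α : ℝ} (φ : holomorphicOnSector α →L[ℂ] ℂ) (z : ℂ) : ℂ := φ (expNeg α z)

/-- The functional `φ ∈ H(S_α)'` is induced by the measure `μ`: `⟨g, φ⟩ = ∫ g dμ`. -/
def IsInducedBy {α : ℝ} (φ : holomorphicOnSector α →L[ℂ] ℂ) (μ : ComplexMeasure (sector α)) :
    Prop :=
  ∀ g : holomorphicOnSector α, φ g = cintegral μ (fun ξ => (g : C(sector α, ℂ)) ξ)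

/-! ### Spectral radius and radical -/

/-- The spectral radius of an element of a complex Banach algebra that need not have a unit; the
quasispectrum is the spectrum in the unitization. -/
def rho {B : Type*} [NonUnitalRing B] [Module ℂ B] (b : B) : ℝ≥0∞ :=
  ⨆ k ∈ quasispectrum ℂ b, (‖k‖₊ : ℝ≥0∞)

theorem rho_eq_zero_iff {B : Type*} [NonUnitalRing B] [Module ℂ B] (b : B) :
    rho b = 0 ↔ ∀ k ∈ quasispectrum ℂ b, k = 0 := by
  simp [rho]

section Radical

variable (C : Type*) [NonUnitalNormedCommRing C] [NormedSpace ℂ C] [IsScalarTower ℂ C C]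
  [SMulCommClass ℂ C C] [CompleteSpace C]

/-- In a commutative Banach algebra the quasinilpotent elements are those that are killed by all
characters of the unitization. -/
theorem rho_eq_zero_iff_forall_algHom (a : C) :
    rho a = 0 ↔ ∀ f : Unitization ℂ C →ₐ[ℂ] ℂ, f (a : Unitization ℂ C) = 0 := by
  rw [rho_eq_zero_iff, Unitization.quasispectrum_eq_spectrum_inr]
  constructor
  · intro h f
    exact h _ (AlgHom.apply_mem_spectrum f _)
  · intro h k hk
    let _ : NormedCommRing (WithLp 1 (Unitization ℂ C)) :=
      { WithLp.instUnitizationNormedRing (𝕜 := ℂ) (A := C) with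
        mul_comm := fun x y => by
          apply (WithLp.unitizationAlgEquiv (𝕜 := ℂ) (A := C) ℂ).injective
          rw [map_mul, map_mul, mul_comm] }
    have hk' : k ∈ spectrum ℂ
        ((WithLp.unitizationAlgEquiv (𝕜 := ℂ) (A := C) ℂ).symm (a : Unitization ℂ C)) := by
      rwa [AlgEquiv.spectrum_eq]
    obtain ⟨f, hf⟩ := WeakDual.CharacterSpace.mem_spectrum_iff_exists.1 hk'
    have := h ((WeakDual.CharacterSpace.toAlgHom f).comp
      (WithLp.unitizationAlgEquiv (𝕜 := ℂ) (A := C) ℂ).symm.toAlgHom)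
    rw [← hf]
    exact this

/-- The radical of a commutative complex Banach algebra: the set of all elements with spectral
radius zero. -/
def radical : Submodule ℂ C where
  carrier := {a | rho a = 0}
  add_mem' := by
    intro a b ha hb
    simp only [Set.mem_ofPred_eq, rho_eq_zero_iff_forall_algHom] at *
    intro f
    rw [Unitization.inr_add, map_add, ha f, hb f, add_zero]
  zero_mem' := by
    simp only [Set.mem_ofPred_eq, rho_eq_zero_iff_forall_algHom]
    intro f
    rw [Unitization.inr_zero, map_zero]
  smul_mem' := by
    intro c a ha
    simp only [Set.mem_ofPred_eq, rho_eq_zero_iff_forall_algHom] at *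
    intro f
    rw [Unitization.inr_smul, map_smul, ha f, smul_zero]

variable {C}

theorem mul_mem_radical_left {a : C} (b : C) (ha : a ∈ radical C) : b * a ∈ radical C := by
  change rho a = 0 at ha
  change rho (b * a) = 0
  rw [rho_eq_zero_iff_forall_algHom] at *
  intro f
  rw [Unitization.inr_mul, map_mul, ha f, mul_zero]

/-- The radical is closed, so that the quotient norm on `C / rad C` is a norm. -/
instance isClosed_radical : IsClosed (radical C : Set C) := by
  have h : (radical C : Set C) = ⋂ f : Unitization ℂ C →ₐ[ℂ] ℂ,
      {a : C | f (a : Unitization ℂ C) = 0} := by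
    ext a
    rw [Set.mem_iInter]
    exact rho_eq_zero_iff_forall_algHom C a
  rw [h]
  refine isClosed_iInter fun f => ?_
  have hf : Continuous
      (f.comp (WithLp.unitizationAlgEquiv (𝕜 := ℂ) (A := C) ℂ).toAlgHom) :=
    map_continuous _
  exact isClosed_eq (hf.comp (WithLp.unitization_isometry_inr (𝕜 := ℂ)).continuous)
    continuous_const

/-- The quotient algebra `C / rad C`, with the quotient norm. -/
abbrev ModRadical (C : Type*) [NonUnitalNormedCommRing C] [NormedSpace ℂ C] [IsScalarTower ℂ C C]
    [SMulCommClass ℂ C C] [CompleteSpace C] : Type _ := C ⧸ radical C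

/-- The product of `C / rad C`, induced by that of `C`. -/
instance : Mul (ModRadical C) where
  mul := Quotient.map₂ (fun a b => a * b) (by
    intro a a' haa b b' hbb
    have h1 : a - a' ∈ radical C := (Submodule.quotientRel_def _).1 haa
    have h2 : b - b' ∈ radical C := (Submodule.quotientRel_def _).1 hbb
    refine (Submodule.quotientRel_def _).2 ?_
    have : a * b - a' * b' = b * (a - a') + a' * (b - b') := by
      rw [mul_sub, mul_sub, mul_comm b a, mul_comm b a']; abel
    rw [this]
    exact add_mem (mul_mem_radical_left _ h1) (mul_mem_radical_left _ h2))

/-- The canonical surjection `π : C → C / rad C`. -/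
def modRad (a : C) : ModRadical C := (radical C).mkQ a

theorem modRad_mul (a b : C) : modRad (a * b) = modRad a * modRad b := rfl

end Radical

/-! ### Analytic semigroups on the sector -/

/-- An analytic semigroup `(T(t))_{t ∈ S_α}` in a Banach algebra `B`; the values of `toFun` off the
sector are irrelevant. -/
structure AnalyticSemigroup (α : ℝ) (B : Type*) [NonUnitalNormedRing B] [NormedSpace ℂ B] where
  toFun : ℂ → B
  differentiableOn : DifferentiableOn ℂ toFun (sector α)
  map_add : ∀ s ∈ sector α, ∀ t ∈ sector α, toFun (s + t) = toFun s * toFun t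

namespace AnalyticSemigroup

variable {α : ℝ} {B : Type*} [NonUnitalNormedRing B] [NormedSpace ℂ B] [IsScalarTower ℂ B B]
  [SMulCommClass ℂ B B]

/-- The semigroup is quasinilpotent if all its elements have spectral radius zero. -/
def IsQuasinilpotent (T : AnalyticSemigroup α B) : Prop := ∀ t ∈ sector α, rho (T.toFun t) = 0

/-- The closed subalgebra generated by the semigroup. -/
def algebra (T : AnalyticSemigroup α B) : NonUnitalSubalgebra ℂ B :=
  (NonUnitalAlgebra.adjoin ℂ (T.toFun '' sector α)).topologicalClosure

theorem mem_algebra (T : AnalyticSemigroup α B) (t : sector α) : T.toFun t ∈ T.algebra :=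
  NonUnitalSubalgebra.le_topologicalClosure _
    (NonUnitalAlgebra.subset_adjoin ℂ (Set.mem_image_of_mem _ t.2))

/-- The elements of the semigroup, as elements of the closed subalgebra they generate. -/
def elem (T : AnalyticSemigroup α B) (t : sector α) : T.algebra := ⟨T.toFun t, T.mem_algebra t⟩

theorem algebra_mul_comm (T : AnalyticSemigroup α B) (x y : T.algebra) : x * y = y * x := by
  have hcomm : ∀ x y : NonUnitalAlgebra.adjoin ℂ (T.toFun '' sector α), x * y = y * x :=
    (NonUnitalAlgebra.adjoinNonUnitalCommRingOfComm ℂ (by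
      rintro _ ⟨s, hs, rfl⟩ _ ⟨t, ht, rfl⟩
      rw [← T.map_add s hs t ht, ← T.map_add t ht s hs, add_comm])).mul_comm
  exact (NonUnitalSubalgebra.nonUnitalCommRingTopologicalClosure _ hcomm).mul_comm x y

instance (T : AnalyticSemigroup α B) : NonUnitalNormedCommRing T.algebra :=
  { NonUnitalSubalgebra.nonUnitalNormedRing T.algebra with
    mul_comm := T.algebra_mul_comm }

instance (T : AnalyticSemigroup α B) : NormedSpace ℂ T.algebra where
  norm_smul_le c x := norm_smul_le c (x : B)

instance [CompleteSpace B] (T : AnalyticSemigroup α B) : CompleteSpace T.algebra :=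
  (NonUnitalSubalgebra.isClosed_topologicalClosure _).completeSpace_coe

/-- The functional calculus `f(-tA) = ∫ T(tξ) dμ(ξ)`, where `f` is the Fourier-Borel transform of
the functional induced by `μ` and `A` is the generator of `T`. It is meant for those `t` for
which `tξ` is in the sector for all `ξ` in the support of `μ`. -/
def calculus (T : AnalyticSemigroup α B) (μ : ComplexMeasure (sector α)) (t : ℂ) : B :=
  cintegral μ (fun ξ => T.toFun (t * ξ))

end AnalyticSemigroup

/-- `e` is a unit element. -/
def IsUnitElement {Q : Type*} [Mul Q] (e : Q) : Prop := ∀ x : Q, e * x = x ∧ x * e = x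

/-- `w = exp v = e + ∑_{n ≥ 1} v ^ n / n!` in an algebra with unit element `e`; the iterate of the
multiplication by `v` gives `v ^ n`. -/
def IsExp {Q : Type*} [Mul Q] [AddCommMonoid Q] [Module ℂ Q] [TopologicalSpace Q] (e v w : Q) :
    Prop :=
  HasSum (fun n : ℕ => ((n.factorial : ℂ)⁻¹) • ((fun x => v * x)^[n] e)) w

end

/-
A character of `𝒜` that is not zero maps `T(t)` to `e^{ct}` for some `c ∈ ℂ`, and it maps `f(-tA)`
to `f(-ct)`, so that `|f(-ct)| ≤ ρ(f(-tA))`. Suppose that the exponents `c` are unbounded. They then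
accumulate at infinity in some direction `v ≠ 0`, and `c = rv + o(r)` with `r → ∞` allows `t = s/r`
for every `s ∈ S_{α-β}`; in the limit `|f(-vs)|` is at most the supremum of `ρ(f(-tA))` over small
`t`. As `|e^{ct}| ≤ ‖T(t)‖`, the direction `-v` has argument at most `π/2 - α`. Hence `f` is bounded
by that supremum on the rotated sector `-v S_{α-β}`, by symmetry also on its complex conjugate, and
by the Phragmén–Lindelöf principle between the two, therefore on `S_{α-β}`, which contradicts the
hypothesis. So the exponents are bounded, and for small `r > 0` the spectrum of `T(r)` consists of
parts of `{0}` and of a small disc about `1`. The Riesz–Dunford integrals of `1` and of `r⁻¹ log`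
around this disc are, modulo the radical, the unit element and the generator.
-/

noncomputable section

section SignedMeasure

variable {X Y E F : Type*} [MeasurableSpace X] [MeasurableSpace Y]
  [NormedAddCommGroup E] [NormedSpace ℝ E] [NormedAddCommGroup F] [NormedSpace ℝ F]

/-- The Bochner integral of a vector-valued function against a signed measure, by means of its
Jordan decomposition. -/
def signedIntegral (s : SignedMeasure X) (g : X → E) : E :=
  ∫ x, g x ∂s.toJordanDecomposition.posPart - ∫ x, g x ∂s.toJordanDecomposition.negPart

theorem posPart_le_totalVariation (s : SignedMeasure X) :
    s.toJordanDecomposition.posPart ≤ s.totalVariation :=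
  Measure.le_add_right le_rfl

theorem negPart_le_totalVariation (s : SignedMeasure X) :
    s.toJordanDecomposition.negPart ≤ s.totalVariation :=
  Measure.le_add_left le_rfl

theorem signedIntegral_congr_ae {s : SignedMeasure X} {g h : X → E}
    (H : g =ᵐ[s.totalVariation] h) : signedIntegral s g = signedIntegral s h := by
  rw [signedIntegral, signedIntegral, integral_congr_ae (ae_mono (posPart_le_totalVariation s) H),
    integral_congr_ae (ae_mono (negPart_le_totalVariation s) H)]

theorem signedIntegral_neg (s : SignedMeasure X) (g : X → E) :
    signedIntegral (-s) g = -signedIntegral s g := by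
  simp only [signedIntegral, SignedMeasure.toJordanDecomposition_neg,
    JordanDecomposition.neg_posPart, JordanDecomposition.neg_negPart, neg_sub]

theorem signedIntegral_comp_comm [CompleteSpace E] [CompleteSpace F] (L : E →L[ℝ] F)
    {s : SignedMeasure X} {g : X → E} (hg : Integrable g s.totalVariation) :
    signedIntegral s (fun x => L (g x)) = L (signedIntegral s g) := by
  simp only [signedIntegral, map_sub,
    L.integral_comp_comm (hg.mono_measure (posPart_le_totalVariation s)),
    L.integral_comp_comm (hg.mono_measure (negPart_le_totalVariation s))]

theorem norm_signedIntegral_le {s : SignedMeasure X} {g : X → E} {C : ℝ}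
    (hg : ∀ᵐ x ∂s.totalVariation, ‖g x‖ ≤ C) :
    ‖signedIntegral s g‖ ≤ C * s.totalVariation.real Set.univ := by
  calc ‖signedIntegral s g‖
    _ ≤ ‖∫ x, g x ∂s.toJordanDecomposition.posPart‖
          + ‖∫ x, g x ∂s.toJordanDecomposition.negPart‖ := norm_sub_le _ _
    _ ≤ C * s.toJordanDecomposition.posPart.real Set.univ
          + C * s.toJordanDecomposition.negPart.real Set.univ :=
        add_le_add (norm_integral_le_of_norm_le_const (ae_mono (posPart_le_totalVariation s) hg))
          (norm_integral_le_of_norm_le_const (ae_mono (negPart_le_totalVariation s) hg))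
    _ = C * s.totalVariation.real Set.univ := by
        rw [SignedMeasure.totalVariation, measureReal_add_apply, mul_add]

/-- The image of a Jordan decomposition under a measurable equivalence. -/
def mapJordan (e : X ≃ᵐ Y) (j : JordanDecomposition X) : JordanDecomposition Y where
  posPart := j.posPart.map e
  negPart := j.negPart.map e
  mutuallySingular := by
    obtain ⟨S, hS, hp, hn⟩ := j.mutuallySingular
    refine ⟨e.symm ⁻¹' S, e.symm.measurable hS, ?_, ?_⟩ <;>
      simpa only [e.map_apply, ← Set.preimage_compl, ← Set.preimage_comp, e.symm_comp_self]

theorem toJordanDecomposition_map (e : X ≃ᵐ Y) (s : SignedMeasure X) :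
    SignedMeasure.toJordanDecomposition (s.map e) = mapJordan e s.toJordanDecomposition := by
  refine SignedMeasure.toJordanDecomposition_eq (VectorMeasure.ext fun S hS => ?_)
  rw [VectorMeasure.map_apply _ e.measurable hS,
    s.apply_eq_posPart_real_sub_negPart_real (e.measurable hS),
    JordanDecomposition.toSignedMeasure, Measure.toSignedMeasure_sub_apply hS]
  simp only [mapJordan, map_measureReal_apply e.measurable hS]

theorem signedIntegral_map_equiv (e : X ≃ᵐ Y) (s : SignedMeasure X) (g : Y → E) :
    signedIntegral (s.map e) g = signedIntegral s (g ∘ e) := by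
  simp only [signedIntegral, toJordanDecomposition_map, mapJordan, integral_map_equiv,
    Function.comp_apply]

theorem totalVariation_eq_zero {s : SignedMeasure X} {N : Set X} (hN : MeasurableSet N)
    (h : ∀ S ⊆ N, MeasurableSet S → s S = 0) : s.totalVariation N = 0 := by
  obtain ⟨P, hP, h0, h1, hp, hn⟩ := s.toJordanDecomposition_spec
  rw [SignedMeasure.totalVariation, Measure.add_apply, hp, hn,
    SignedMeasure.toMeasureOfZeroLE_apply _ h0 hP hN,
    SignedMeasure.toMeasureOfLEZero_apply _ h1 hP.compl hN]
  simp [h _ Set.inter_subset_right (hP.inter hN), h _ Set.inter_subset_right (hP.compl.inter hN)]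

end SignedMeasure

section ComplexMeasure

variable {X E F : Type*} [MeasurableSpace X] [NormedAddCommGroup E] [NormedSpace ℂ E]
  [NormedAddCommGroup F] [NormedSpace ℂ F]

/-- The sum of the total variations of the real and the imaginary part of a complex measure. It has
the same null sets as the total variation of `μ` and is comparable to it. -/
def jordanVariation (μ : ComplexMeasure X) : Measure X :=
  (ComplexMeasure.re μ).totalVariation + (ComplexMeasure.im μ).totalVariation

instance (μ : ComplexMeasure X) : IsFiniteMeasure (jordanVariation μ) := by
  unfold jordanVariation SignedMeasure.totalVariation
  infer_instance

theorem cintegral_eq_signedIntegral (μ : ComplexMeasure X) (g : X → E) :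
    cintegral μ g = signedIntegral (ComplexMeasure.re μ) g
      + Complex.I • signedIntegral (ComplexMeasure.im μ) g := rfl

theorem totalVariation_re_le (μ : ComplexMeasure X) :
    (ComplexMeasure.re μ).totalVariation ≤ jordanVariation μ :=
  Measure.le_add_right le_rfl

theorem totalVariation_im_le (μ : ComplexMeasure X) :
    (ComplexMeasure.im μ).totalVariation ≤ jordanVariation μ :=
  Measure.le_add_left le_rfl

theorem cintegral_congr_ae {μ : ComplexMeasure X} {g h : X → E}
    (H : g =ᵐ[jordanVariation μ] h) : cintegral μ g = cintegral μ h := by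
  rw [cintegral_eq_signedIntegral, cintegral_eq_signedIntegral,
    signedIntegral_congr_ae (ae_mono (totalVariation_re_le μ) H),
    signedIntegral_congr_ae (ae_mono (totalVariation_im_le μ) H)]

theorem cintegral_comp_comm [CompleteSpace E] [CompleteSpace F] (L : E →L[ℂ] F)
    {μ : ComplexMeasure X} {g : X → E} (hg : Integrable g (jordanVariation μ)) :
    cintegral μ (fun x => L (g x)) = L (cintegral μ g) := by
  have hre := signedIntegral_comp_comm (L.restrictScalars ℝ)
    (hg.mono_measure (totalVariation_re_le μ))
  have him := signedIntegral_comp_comm (L.restrictScalars ℝ)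
    (hg.mono_measure (totalVariation_im_le μ))
  rw [ContinuousLinearMap.coe_restrictScalars'] at hre him
  rw [cintegral_eq_signedIntegral, cintegral_eq_signedIntegral, hre, him, map_add, map_smul]

theorem norm_cintegral_le {μ : ComplexMeasure X} {g : X → E} {C : ℝ}
    (hg : ∀ᵐ x ∂jordanVariation μ, ‖g x‖ ≤ C) :
    ‖cintegral μ g‖ ≤ C * (jordanVariation μ).real Set.univ := by
  calc ‖cintegral μ g‖
    _ ≤ ‖signedIntegral (ComplexMeasure.re μ) g‖ + ‖signedIntegral (ComplexMeasure.im μ) g‖ := by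
        rw [cintegral_eq_signedIntegral]
        refine (norm_add_le _ _).trans_eq ?_
        rw [norm_smul, Complex.norm_I, one_mul]
    _ ≤ C * (ComplexMeasure.re μ).totalVariation.real Set.univ
          + C * (ComplexMeasure.im μ).totalVariation.real Set.univ :=
        add_le_add (norm_signedIntegral_le (ae_mono (totalVariation_re_le μ) hg))
          (norm_signedIntegral_le (ae_mono (totalVariation_im_le μ) hg))
    _ = C * (jordanVariation μ).real Set.univ := by
        have := isFiniteMeasure_of_le _ (totalVariation_re_le μ)
        have := isFiniteMeasure_of_le _ (totalVariation_im_le μ)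
        rw [jordanVariation, measureReal_add_apply, mul_add]

theorem cintegral_comp_equiv_eq_conj {μ : ComplexMeasure X} (e : X ≃ᵐ X)
    (h : ∀ S, MeasurableSet S → μ (e ⁻¹' S) = conj (μ S)) (g : X → ℂ) :
    cintegral μ (fun x => g (e x)) = conj (cintegral μ fun x => conj (g x)) := by
  have hre : (ComplexMeasure.re μ).map e = ComplexMeasure.re μ := VectorMeasure.ext fun S hS => by
    rw [VectorMeasure.map_apply _ e.measurable hS]
    exact (congrArg Complex.re (h S hS)).trans (Complex.conj_re _)
  have him : (ComplexMeasure.im μ).map e = -ComplexMeasure.im μ := VectorMeasure.ext fun S hS => by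
    rw [VectorMeasure.map_apply _ e.measurable hS]
    exact (congrArg Complex.im (h S hS)).trans (Complex.conj_im _)
  have hconj (s : SignedMeasure X) :
      signedIntegral s (fun x => conj (g x)) = conj (signedIntegral s g) := by
    simp only [signedIntegral, integral_conj, map_sub]
  change cintegral μ (g ∘ e) = _
  rw [cintegral_eq_signedIntegral, ← signedIntegral_map_equiv, ← signedIntegral_map_equiv, hre,
    him, signedIntegral_neg, cintegral_eq_signedIntegral, hconj, hconj]
  simp

theorem CarriedBy.ae_mem {μ : ComplexMeasure X} {K : Set X} (h : CarriedBy μ K)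
    (hK : MeasurableSet K) : ∀ᵐ x ∂jordanVariation μ, x ∈ K := by
  have h0 (S : Set X) (hS : S ⊆ Kᶜ) (hSm : MeasurableSet S) : μ S = 0 :=
    h S hSm (Set.disjoint_left.2 fun _ hx => hS hx)
  rw [ae_iff]
  change ((ComplexMeasure.re μ).totalVariation + (ComplexMeasure.im μ).totalVariation) Kᶜ = 0
  rw [Measure.add_apply,
    totalVariation_eq_zero hK.compl fun S hS hSm => congrArg Complex.re (h0 S hS hSm),
    totalVariation_eq_zero hK.compl fun S hS hSm => congrArg Complex.im (h0 S hS hSm), add_zero]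

end ComplexMeasure

section Sector

variable {α : ℝ} {z w : ℂ}

theorem ne_zero_of_mem_sector (hz : z ∈ sector α) : z ≠ 0 := by
  rintro rfl
  exact lt_irrefl _ hz.1

theorem isOpen_sector (α : ℝ) : IsOpen (sector α) :=
  ContinuousOn.isOpen_inter_preimage (s := {z : ℂ | 0 < z.re}) (t := {θ | |θ| < α})
    (fun _ hz => (Complex.continuousAt_arg (Or.inl hz)).continuousWithinAt)
    (isOpen_lt continuous_const Complex.continuous_re) (isOpen_lt continuous_abs continuous_const)

theorem continuous_arg_sector : Continuous fun ξ : sector α => (ξ : ℂ).arg :=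
  continuous_iff_continuousAt.2 fun ξ =>
    (Complex.continuousAt_arg (Or.inl ξ.2.1)).comp continuous_subtype_val.continuousAt

theorem mem_sector_iff (h0 : 0 ≤ α) (hα : α ≤ Real.pi / 2) :
    z ∈ sector α ↔ ‖z‖ * Real.cos α < z.re := by
  have hre : ‖z‖ * Real.cos α < z.re → 0 < z.re :=
    (mul_nonneg (norm_nonneg z) (Real.cos_nonneg_of_mem_Icc ⟨by linarith, hα⟩)).trans_lt
  refine ⟨fun hz => ?_, fun h => ⟨hre h, ?_⟩⟩
  · rw [← Complex.norm_mul_cos_arg z, ← Real.cos_abs z.arg]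
    exact mul_lt_mul_of_pos_left
      (Real.cos_lt_cos_of_nonneg_of_le_pi_div_two (abs_nonneg _) hα hz.2)
      (norm_pos_iff.2 (ne_zero_of_mem_sector hz))
  · contrapose! h
    rw [← Complex.norm_mul_cos_arg z, ← Real.cos_abs z.arg]
    exact mul_le_mul_of_nonneg_left
      (Real.cos_le_cos_of_nonneg_of_le_pi h0 (Complex.abs_arg_le_pi z) h) (norm_nonneg z)

theorem pos_of_mem_sector (hz : z ∈ sector α) : 0 < α :=
  (abs_nonneg _).trans_lt hz.2

theorem add_mem_sector (hα : α ≤ Real.pi / 2) (hz : z ∈ sector α) (hw : w ∈ sector α) :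
    z + w ∈ sector α := by
  have h0 := (pos_of_mem_sector hz).le
  rw [mem_sector_iff h0 hα] at hz hw ⊢
  calc ‖z + w‖ * Real.cos α
    _ ≤ (‖z‖ + ‖w‖) * Real.cos α :=
        mul_le_mul_of_nonneg_right (norm_add_le z w)
          (Real.cos_nonneg_of_mem_Icc ⟨by linarith, hα⟩)
    _ < (z + w).re := by rw [add_mul]; exact add_lt_add hz hw

theorem real_mul_mem_sector {r : ℝ} (hr : 0 < r) (hz : z ∈ sector α) :
    (r : ℂ) * z ∈ sector α := by
  refine ⟨?_, ?_⟩
  · rw [Complex.re_ofReal_mul]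
    exact mul_pos hr hz.1
  · rw [Complex.arg_real_mul _ hr]
    exact hz.2

theorem ofReal_mem_sector (hα : 0 < α) {r : ℝ} (hr : 0 < r) : (r : ℂ) ∈ sector α :=
  ⟨by simpa using hr, by rwa [Complex.arg_ofReal_of_nonneg hr.le, abs_zero]⟩

theorem convex_sector (hα : α ≤ Real.pi / 2) : Convex ℝ (sector α) :=
  convex_iff_forall_pos.2 fun z hz w hw a b ha hb _ => by
    simpa only [Complex.real_smul] using
      add_mem_sector hα (real_mul_mem_sector ha hz) (real_mul_mem_sector hb hw)

theorem exp_mem_sector (hα : α ≤ Real.pi / 2) (hw : |w.im| < α) : Complex.exp w ∈ sector α := by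
  have h := abs_lt.1 hw
  refine ⟨?_, ?_⟩
  · rw [Complex.exp_re]
    exact mul_pos (Real.exp_pos _) (Real.cos_pos_of_mem_Ioo ⟨by linarith, by linarith⟩)
  · rwa [Complex.arg_exp, (toIocMod_eq_self _).2 ⟨by linarith, by linarith⟩]

theorem mul_mem_sector {δ : ℝ} (hα : α ≤ Real.pi / 2) (hz : z ∈ sector (α - δ)) (hw0 : w ≠ 0)
    (hw : |w.arg| ≤ δ) : z * w ∈ sector α := by
  rw [← Complex.exp_log (ne_zero_of_mem_sector hz), ← Complex.exp_log hw0, ← Complex.exp_add]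
  apply exp_mem_sector hα
  rw [Complex.add_im, Complex.log_im, Complex.log_im]
  linarith [abs_add_le z.arg w.arg, hz.2]

theorem abs_arg_le_of_forall_re_mul_nonneg (h0 : 0 < α) (hα : α ≤ Real.pi / 2) {ω : ℂ}
    (h : ∀ s ∈ sector α, 0 ≤ (ω * s).re) : |ω.arg| ≤ Real.pi / 2 - α := by
  by_contra! hω
  obtain ⟨θ, hθ, hθα⟩ := exists_between
    (show max 0 (Real.pi / 2 - |ω.arg|) < α from max_lt h0 (by linarith))
  obtain ⟨hθ0, hθω⟩ := max_lt_iff.1 hθ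
  have hω0 : ω ≠ 0 := by
    rintro rfl
    rw [Complex.arg_zero, abs_zero] at hω
    linarith
  obtain ⟨τ, hτ, hτω⟩ : ∃ τ : ℝ, |τ| < α ∧ |ω.arg + τ| = |ω.arg| + θ := by
    rcases le_total 0 ω.arg with harg | harg
    · exact ⟨θ, by rwa [abs_of_pos hθ0], by
        rw [abs_of_nonneg harg, abs_of_nonneg (by linarith)]⟩
    · exact ⟨-θ, by rwa [abs_neg, abs_of_pos hθ0], by
        rw [abs_of_nonpos harg, abs_of_nonpos (by linarith), neg_add, neg_neg]⟩
  have hre : (ω * Complex.exp (τ * Complex.I)).re = ‖ω‖ * Real.cos (|ω.arg| + θ) := by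
    rw [← hτω, Real.cos_abs]
    nth_rewrite 1 [← Complex.norm_mul_exp_arg_mul_I ω]
    rw [mul_assoc, ← Complex.exp_add, ← add_mul, ← Complex.ofReal_add, Complex.re_ofReal_mul,
      Complex.exp_ofReal_mul_I_re]
  refine (h _ (exp_mem_sector hα (w := τ * Complex.I) (by simpa using hτ))).not_gt ?_
  rw [hre]
  exact mul_neg_of_pos_of_neg (norm_pos_iff.2 hω0)
    (Real.cos_neg_of_pi_div_two_lt_of_lt (by linarith) (by linarith [Complex.abs_arg_le_pi ω]))

end Sector

section PhragmenLindelof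

variable {E : Type*} [NormedAddCommGroup E] [NormedSpace ℂ E]

/-- The symmetry bounds `g` on the strips of half-width `γ` around the lines `im w = ±ψ`. If these
leave a gap around the real axis, the Phragmén–Lindelöf principle fills it. -/
theorem norm_le_of_norm_le_of_abs_im_sub_lt {g : ℂ → E} {ψ γ C m : ℝ} (hγ : 0 < γ)
    (hg : DiffContOnCl ℂ g (Complex.im ⁻¹' Set.Ioo (-|ψ|) |ψ|))
    (hconj : ∀ w, ‖g (conj w)‖ = ‖g w‖) (hC : ∀ w, |w.im| < |ψ| → ‖g w‖ ≤ C)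
    (hm : ∀ w, |w.im - ψ| < γ → ‖g w‖ ≤ m) {w : ℂ} (hw : |w.im| < γ) : ‖g w‖ ≤ m := by
  have habs (w : ℂ) (hw : |(|w.im| - |ψ|)| < γ) : ‖g w‖ ≤ m := by
    rcases abs_choice w.im with h | h <;> rcases abs_choice ψ with h' | h' <;> rw [h, h'] at hw
    · exact hm w hw
    · rw [← hconj]
      exact hm _ (by rwa [Complex.conj_im, ← abs_neg, neg_sub', neg_neg])
    · rw [← hconj]
      exact hm _ hw
    · exact hm w (by rwa [neg_sub_neg, abs_sub_comm] at hw)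
  rcases le_or_gt |ψ| |w.im| with h | h
  · exact habs w (by rw [abs_of_nonneg (sub_nonneg.2 h)]; linarith [abs_nonneg ψ])
  have hψ : 0 < |ψ| := (abs_nonneg _).trans_lt h
  have hbdry (z : ℂ) (hz : |z.im| = |ψ|) : ‖g z‖ ≤ m := habs z (by rwa [hz, sub_self, abs_zero])
  refine PhragmenLindelof.horizontal_strip hg
    ⟨0, div_pos Real.pi_pos (by linarith), 0, Asymptotics.IsBigO.of_bound C ?_⟩
    (fun z hz => hbdry z (by rw [hz, abs_neg, abs_abs]))
    (fun z hz => hbdry z (by rw [hz, abs_abs])) (abs_le.1 h.le).1 (abs_le.1 h.le).2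
  filter_upwards [Filter.mem_inf_of_right (Filter.mem_principal_self _)] with z hz
  simpa using hC z (abs_lt.2 hz)

theorem norm_le_on_sector_of_norm_le_on_rotated {F : ℂ → E} (hF : Differentiable ℂ F)
    (hconj : ∀ z, ‖F (conj z)‖ = ‖F z‖) {δ γ C m : ℝ} (hδ : δ ≤ Real.pi / 2)
    (hC : ∀ z ∈ sector δ, ‖F z‖ ≤ C) (hγ : γ ≤ Real.pi / 2) {ω : ℂ} (hω : ω ≠ 0)
    (hωδ : |ω.arg| ≤ δ) (hm : ∀ s ∈ sector γ, ‖F (ω * s)‖ ≤ m) : ∀ z ∈ sector γ, ‖F z‖ ≤ m := by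
  intro z hz
  rw [← Complex.exp_log (ne_zero_of_mem_sector hz)]
  refine norm_le_of_norm_le_of_abs_im_sub_lt (g := fun w => F (Complex.exp w)) (ψ := ω.arg)
    (pos_of_mem_sector hz) (hF.comp Complex.differentiable_exp).diffContOnCl (fun w => ?_)
    (fun w hw => hC _ (exp_mem_sector hδ (hw.trans_le hωδ))) (fun w hw => ?_)
    (by rw [Complex.log_im]; exact hz.2)
  · rw [Complex.exp_conj, hconj]
  · have hw' : Complex.exp w = ω * Complex.exp (w - Complex.log ω) := by
      rw [Complex.exp_sub, Complex.exp_log hω, mul_div_cancel₀ _ hω]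
    rw [hw']
    exact hm _ (exp_mem_sector hγ (by rwa [Complex.sub_im, Complex.log_im]))

end PhragmenLindelof

section CompactSupport

variable {X E : Type*} [TopologicalSpace X] [T2Space X] [MeasurableSpace X]
  [OpensMeasurableSpace X] {μ : ComplexMeasure X}

theorem HasCompactSupp.exists_ae_mem (hμ : HasCompactSupp μ) :
    ∃ K, IsCompact K ∧ ∀ᵐ x ∂jordanVariation μ, x ∈ K :=
  let ⟨K, hK, hμK⟩ := hμ
  ⟨K, hK, hμK.ae_mem hK.measurableSet⟩

theorem integrable_of_continuousOn_of_ae_mem [NormedAddCommGroup E] {p : Measure X}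
    [IsFiniteMeasureOnCompacts p] {K : Set X} (hK : IsCompact K) (hp : ∀ᵐ x ∂p, x ∈ K) {g : X → E}
    (hg : ContinuousOn g K) : Integrable g p := by
  rw [← Measure.restrict_eq_self_of_ae_mem hp]
  exact hg.integrableOn_compact' hK hK.measurableSet

end CompactSupport

section ExpIntegral

variable {X : Type*} [MeasurableSpace X] {h : X → ℂ} {R : ℝ}

theorem differentiable_integral_exp {p : Measure X} [IsFiniteMeasure p]
    (hm : AEStronglyMeasurable h p) (hR : ∀ᵐ x ∂p, ‖h x‖ ≤ R) :
    Differentiable ℂ fun z : ℂ => ∫ x, Complex.exp (z * h x) ∂p := by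
  intro z₀
  have hnorm {z : ℂ} {x : X} (hx : ‖h x‖ ≤ R) : ‖Complex.exp (z * h x)‖ ≤ Real.exp (‖z‖ * R) := by
    rw [Complex.norm_exp]
    gcongr
    exact (Complex.re_le_norm _).trans ((norm_mul_le _ _).trans (by gcongr))
  have hmeas (z : ℂ) : AEStronglyMeasurable (fun x => Complex.exp (z * h x)) p :=
    Complex.continuous_exp.comp_aestronglyMeasurable (hm.const_mul z)
  refine (hasDerivAt_integral_of_dominated_loc_of_deriv_le (𝕜 := ℂ)
    (F' := fun z x => Complex.exp (z * h x) * (1 * h x))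
    (bound := fun _ => Real.exp ((‖z₀‖ + 1) * R) * R)
    (Metric.ball_mem_nhds z₀ one_pos) (.of_forall hmeas)
    (.of_bound (hmeas z₀) _ (hR.mono fun x hx => hnorm hx))
    ((hmeas z₀).mul (hm.const_mul 1)) ?_ (integrable_const _)
    (.of_forall fun x z _ => ((hasDerivAt_id z).mul_const (h x)).cexp)).2.differentiableAt
  filter_upwards [hR] with x hx z hz
  have hR0 : 0 ≤ R := (norm_nonneg _).trans hx
  have hz' : ‖z‖ ≤ ‖z₀‖ + 1 := (norm_lt_of_mem_ball hz).le
  rw [one_mul, norm_mul]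
  gcongr
  exact (hnorm hx).trans (by gcongr)

theorem differentiable_cintegral_exp {μ : ComplexMeasure X}
    (hm : AEStronglyMeasurable h (jordanVariation μ)) (hR : ∀ᵐ x ∂jordanVariation μ, ‖h x‖ ≤ R) :
    Differentiable ℂ fun z : ℂ => cintegral μ fun x => Complex.exp (z * h x) := by
  have key {p : Measure X} [IsFiniteMeasure p] (hp : p ≤ jordanVariation μ) :
      Differentiable ℂ fun z : ℂ => ∫ x, Complex.exp (z * h x) ∂p :=
    differentiable_integral_exp (hm.mono_measure hp) (ae_mono hp hR)
  have hre := totalVariation_re_le μ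
  have him := totalVariation_im_le μ
  exact ((key ((posPart_le_totalVariation _).trans hre)).sub
    (key ((negPart_le_totalVariation _).trans hre))).add
    (((key ((posPart_le_totalVariation _).trans him)).sub
      (key ((negPart_le_totalVariation _).trans him))).const_smul Complex.I)

end ExpIntegral

section Laplace

variable {α : ℝ} {μ : ComplexMeasure (sector α)}

/-- The Laplace transform `z ↦ ∫ e^{-zξ} dμ(ξ)` of a complex measure on the sector. -/
def laplace (μ : ComplexMeasure (sector α)) (z : ℂ) : ℂ :=
  cintegral μ fun ξ => Complex.exp (-z * ξ)

theorem IsInducedBy.fourierBorel_eq {φ : holomorphicOnSector α →L[ℂ] ℂ} (hφ : IsInducedBy φ μ)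
    (z : ℂ) : fourierBorel φ z = laplace μ z :=
  hφ (expNeg α z)

theorem HasCompactSupp.differentiable_laplace (hμ : HasCompactSupp μ) :
    Differentiable ℂ (laplace μ) := by
  obtain ⟨K, hK, hμK⟩ := hμ.exists_ae_mem
  obtain ⟨R, hR⟩ := (hK.image continuous_subtype_val).isBounded.exists_norm_le
  have hbound : ∀ᵐ ξ : sector α ∂jordanVariation μ, ‖(ξ : ℂ)‖ ≤ R := by
    filter_upwards [hμK] with ξ hξ
    exact hR _ (Set.mem_image_of_mem _ hξ)
  exact (differentiable_cintegral_exp continuous_subtype_val.aestronglyMeasurable hbound).comp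
    differentiable_neg

theorem sectorConj_involutive : Function.Involutive (sectorConj α) := fun _ =>
  Subtype.ext (Complex.conj_conj _)

theorem continuous_sectorConj : Continuous (sectorConj α) :=
  (Complex.continuous_conj.comp continuous_subtype_val).subtype_mk _

theorem IsSymmetricMeasure.laplace_conj (hμ : IsSymmetricMeasure μ) (z : ℂ) :
    laplace μ (conj z) = conj (laplace μ z) := by
  have hpre (S : Set (sector α)) (hS : MeasurableSet S) :
      μ (sectorConj α ⁻¹' S) = conj (μ S) := by
    rw [← hμ S hS, sectorConj_involutive.image_eq_preimage_symm]
  have hexp (ξ : sector α) :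
      Complex.exp (-conj z * ξ) = conj (Complex.exp (-z * sectorConj α ξ)) := by
    rw [← Complex.exp_conj, map_mul, map_neg, sectorConj, Complex.conj_conj]
  simp only [laplace, hexp]
  refine (cintegral_comp_equiv_eq_conj
    (.ofInvolutive _ sectorConj_involutive continuous_sectorConj.measurable) hpre
    fun ξ => conj (Complex.exp (-z * ξ))).trans ?_
  simp only [Complex.conj_conj]

theorem norm_laplace_le (μ : ComplexMeasure (sector α)) {z : ℂ}
    (hz : z ∈ sector (Real.pi / 2 - α)) :
    ‖laplace μ z‖ ≤ (jordanVariation μ).real Set.univ := by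
  refine (norm_cintegral_le (C := 1) (.of_forall fun ξ => ?_)).trans_eq (one_mul _)
  have hre : 0 < (z * ξ).re :=
    (mul_mem_sector le_rfl hz (ne_zero_of_mem_sector ξ.2) ξ.2.2.le).1
  rw [Complex.norm_exp, Real.exp_le_one_iff, neg_mul, Complex.neg_re, neg_nonpos]
  exact hre.le

end Laplace

section Multiplicative

variable {S : Set ℂ} {h : ℂ → ℂ}

theorem deriv_mul_eq_of_map_add (hS : IsOpen S) (hadd : ∀ s ∈ S, ∀ t ∈ S, s + t ∈ S)
    (hd : DifferentiableOn ℂ h S) (hmul : ∀ s ∈ S, ∀ t ∈ S, h (s + t) = h s * h t) {s t : ℂ}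
    (hs : s ∈ S) (ht : t ∈ S) : deriv h s * h t = deriv h t * h s := by
  have hder {s t : ℂ} (hs : s ∈ S) (ht : t ∈ S) : deriv h (s + t) = deriv h s * h t := by
    have hda {u : ℂ} (hu : u ∈ S) : HasDerivAt h (deriv h u) u :=
      (hd.differentiableAt (hS.mem_nhds hu)).hasDerivAt
    refine ((hda (hadd s hs t ht)).comp_add_const s t).unique
      (((hda hs).mul_const (h t)).congr_of_eventuallyEq ?_)
    filter_upwards [hS.mem_nhds hs] with x hx
    exact hmul x hx t ht
  rw [← hder hs ht, ← hder ht hs, add_comm]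

theorem eqOn_zero_or_exists_eqOn_exp (hS : IsOpen S) (hSc : IsPreconnected S)
    (hadd : ∀ s ∈ S, ∀ t ∈ S, s + t ∈ S) (hd : DifferentiableOn ℂ h S)
    (hmul : ∀ s ∈ S, ∀ t ∈ S, h (s + t) = h s * h t) :
    Set.EqOn h 0 S ∨ ∃ c : ℂ, Set.EqOn h (fun t => Complex.exp (c * t)) S := by
  refine or_iff_not_imp_left.2 fun hne => ?_
  obtain ⟨s, hs, hs0⟩ : ∃ s ∈ S, h s ≠ 0 := by
    simpa only [Set.EqOn, Pi.zero_apply, not_forall, exists_prop] using hne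
  set c := deriv h s / h s with hc
  have hderiv (t : ℂ) (ht : t ∈ S) : HasDerivAt h (c * h t) t := by
    rw [hc, div_mul_eq_mul_div, deriv_mul_eq_of_map_add hS hadd hd hmul hs ht,
      mul_div_cancel_right₀ _ hs0]
    exact (hd.differentiableAt (hS.mem_nhds ht)).hasDerivAt
  let k : ℂ → ℂ := fun t => h t * Complex.exp (-c * t)
  obtain ⟨a, ha⟩ : ∃ a, ∀ t ∈ S, k t = a := by
    refine hS.exists_is_const_of_deriv_eq_zero hSc (hd.mul (by fun_prop)) fun t ht => ?_
    refine ((hderiv t ht).mul ((hasDerivAt_id t).const_mul (-c)).cexp).deriv.trans ?_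
    simp only [id, Pi.zero_apply]
    ring
  have ha1 : a = 1 := by
    have hmul_self : a * a = a := by
      calc a * a = k s * k s := by rw [ha s hs]
        _ = k (s + s) := by simp only [k, hmul s hs s hs, mul_add, Complex.exp_add]; ring
        _ = a := ha _ (hadd s hs s hs)
    have ha0 : a ≠ 0 := ha s hs ▸ mul_ne_zero hs0 (Complex.exp_ne_zero _)
    exact mul_left_cancel₀ ha0 (by rw [hmul_self, mul_one])
  refine ⟨c, fun t ht => ?_⟩
  calc h t = k t * Complex.exp (c * t) := by simp [k, mul_assoc, ← Complex.exp_add]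
    _ = Complex.exp (c * t) := by rw [ha t ht, ha1, one_mul]

end Multiplicative

section Unitization

variable {C : Type*} [NonUnitalNormedRing C] [NormedSpace ℂ C] [IsScalarTower ℂ C C]
  [SMulCommClass ℂ C C]

instance : NormOneClass (WithLp 1 (Unitization ℂ C)) where
  norm_one := by
    rw [WithLp.unitization_norm_def]
    change ‖(1 : Unitization ℂ C).fst‖ + ‖(1 : Unitization ℂ C).snd‖ = 1
    simp only [Unitization.fst_one, Unitization.snd_one, norm_one, norm_zero, add_zero]

theorem rho_eq_spectralRadius (a : C) :
    rho a = spectralRadius ℂ (WithLp.toLp 1 (a : Unitization ℂ C)) := by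
  rw [rho, Unitization.quasispectrum_eq_spectrum_inr, spectralRadius,
    ← AlgEquiv.spectrum_eq (WithLp.unitizationAlgEquiv (𝕜 := ℂ) (A := C) ℂ)]
  rfl

theorem rho_map_of_norm_map [CompleteSpace C] {D : Type*} [NonUnitalNormedRing D]
    [NormedSpace ℂ D] [IsScalarTower ℂ D D] [SMulCommClass ℂ D D] [CompleteSpace D]
    (i : C →ₙₐ[ℂ] D) (hi : ∀ a, ‖i a‖ = ‖a‖) (a : C) : rho (i a) = rho a := by
  let j : Unitization ℂ C →ₐ[ℂ] Unitization ℂ D :=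
    Unitization.lift ((Unitization.inrNonUnitalAlgHom ℂ D).comp i)
  have hj (x : Unitization ℂ C) : ‖WithLp.toLp 1 (j x)‖ = ‖WithLp.toLp 1 x‖ := by
    simp [WithLp.unitization_norm_def, j, hi, Unitization.algebraMap_eq_inl]
  have hpow (n : ℕ) : ‖WithLp.toLp 1 (i a : Unitization ℂ D) ^ n‖₊
      = ‖WithLp.toLp 1 (a : Unitization ℂ C) ^ n‖₊ := by
    have h := hj ((a : Unitization ℂ C) ^ n)
    rw [map_pow, show j a = (i a : Unitization ℂ D) by simp [j]] at h
    exact NNReal.eq h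
  rw [rho_eq_spectralRadius, rho_eq_spectralRadius]
  refine tendsto_nhds_unique
    (spectrum.pow_nnnorm_pow_one_div_tendsto_nhds_spectralRadius _) ?_
  simp only [hpow]
  exact spectrum.pow_nnnorm_pow_one_div_tendsto_nhds_spectralRadius _

end Unitization

section Character

theorem enorm_character_le_rho {A : Type*} [NonUnitalRing A] [Module ℂ A] (χ : A →ₙₐ[ℂ] ℂ)
    (a : A) : ‖χ a‖ₑ ≤ rho a := by
  have hmem : χ a ∈ quasispectrum ℂ a :=
    NonUnitalAlgHom.quasispectrum_apply_subset χ a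
      (spectrum_subset_quasispectrum ℂ (χ a) (by simp [spectrum.mem_iff]))
  exact le_iSup₂ (f := fun k (_ : k ∈ quasispectrum ℂ a) => (‖k‖₊ : ℝ≥0∞)) _ hmem

variable {C : Type*} [NonUnitalNormedRing C] [NormedSpace ℂ C] [IsScalarTower ℂ C C]
  [SMulCommClass ℂ C C] [CompleteSpace C]

theorem norm_character_le (χ : C →ₙₐ[ℂ] ℂ) (a : C) : ‖χ a‖ ≤ ‖a‖ := by
  have h : ‖χ a‖ₑ ≤ ‖WithLp.toLp 1 (a : Unitization ℂ C)‖₊ :=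
    (enorm_character_le_rho χ a).trans
      (rho_eq_spectralRadius a ▸ spectrum.spectralRadius_le_nnnorm _)
  rw [WithLp.unitization_nnnorm_inr] at h
  exact_mod_cast h

/-- A character of a Banach algebra as a continuous linear functional. -/
def characterCLM (χ : C →ₙₐ[ℂ] ℂ) : C →L[ℂ] ℂ :=
  (χ : C →ₗ[ℂ] ℂ).mkContinuous 1 fun a => (norm_character_le χ a).trans_eq (one_mul _).symm

@[simp]
theorem characterCLM_apply (χ : C →ₙₐ[ℂ] ℂ) (a : C) : characterCLM χ a = χ a := rfl

end Character

section Radical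

variable {C : Type*} [NonUnitalNormedCommRing C] [NormedSpace ℂ C] [IsScalarTower ℂ C C]
  [SMulCommClass ℂ C C] [CompleteSpace C]

theorem modRad_eq_iff {a b : C} : modRad a = modRad b ↔ ∀ χ : C →ₙₐ[ℂ] ℂ, χ a = χ b := by
  refine (Submodule.Quotient.eq (radical C)).trans
    ((rho_eq_zero_iff_forall_algHom C (a - b)).trans ?_)
  refine Unitization.lift.symm.forall_congr fun f => ?_
  rw [Unitization.inr_sub, map_sub, sub_eq_zero]
  rfl

theorem isUnitElement_modRad {e : C} (h : ∀ χ : C →ₙₐ[ℂ] ℂ, ∀ a, χ a = 0 ∨ χ e = 1) :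
    IsUnitElement (modRad e) := by
  intro x
  obtain ⟨a, rfl⟩ := (radical C).mkQ_surjective x
  have hea : modRad (e * a) = modRad a := by
    refine modRad_eq_iff.2 fun χ => ?_
    rw [map_mul]
    rcases h χ a with h | h
    · rw [h, mul_zero]
    · rw [h, one_mul]
  exact ⟨hea, (congrArg modRad (mul_comm a e)).trans hea⟩

end Radical

section Dunford

theorem circleIntegral_comp_comm {E F : Type*} [NormedAddCommGroup E] [NormedSpace ℂ E]
    [CompleteSpace E] [NormedAddCommGroup F] [NormedSpace ℂ F] [CompleteSpace F] (L : E →L[ℂ] F)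
    {g : ℂ → E} {c : ℂ} {R : ℝ} (hg : CircleIntegrable g c R) :
    (∮ z in C(c, R), L (g z)) = L (∮ z in C(c, R), g z) := by
  simp only [circleIntegral]
  rw [← L.intervalIntegral_comp_comm hg.out]
  simp only [map_smul]

variable {A : Type*} [NormedRing A] [NormedAlgebra ℂ A]

/-- The Riesz–Dunford integral of the holomorphic functional calculus of `x` over the circle with
centre `c` and radius `R`. The circle may separate the spectrum of `x`. -/
def dunford (x : A) (g : ℂ → ℂ) (c : ℂ) (R : ℝ) : A :=
  (2 * Real.pi * Complex.I : ℂ)⁻¹ • ∮ z in C(c, R), g z • resolvent x z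

variable {x : A} {g : ℂ → ℂ} {c : ℂ} {R : ℝ}

theorem algHom_resolvent (f : A →ₐ[ℂ] ℂ) {z : ℂ} (hz : z ∈ resolventSet ℂ x) :
    f (resolvent x z) = (z - f x)⁻¹ := by
  have h : f (resolvent x z * (algebraMap ℂ A z - x)) = f 1 :=
    congrArg f (Ring.inverse_mul_cancel _ hz)
  rw [map_mul, map_sub, map_one, AlgHom.commutes] at h
  exact eq_inv_of_mul_eq_one_left h

variable [CompleteSpace A]

theorem algHom_dunford (f : A →ₐ[ℂ] ℂ) (hR : 0 ≤ R) (hg : ContinuousOn g (Metric.sphere c R))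
    (hx : Metric.sphere c R ⊆ resolventSet ℂ x) :
    f (dunford x g c R)
      = (2 * Real.pi * Complex.I : ℂ)⁻¹ • ∮ z in C(c, R), (z - f x)⁻¹ • g z := by
  have hcont : ContinuousOn (fun z => g z • resolvent x z) (Metric.sphere c R) :=
    hg.smul fun z hz =>
      (spectrum.hasDerivAt_resolvent_const_left (hx hz)).continuousAt.continuousWithinAt
  have hcomm := circleIntegral_comp_comm (⟨f.toLinearMap, map_continuous f⟩ : A →L[ℂ] ℂ)
    (hcont.circleIntegrable hR)
  rw [dunford, map_smul]
  refine congrArg _ (hcomm.symm.trans (circleIntegral.integral_congr hR fun z hz => ?_))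
  change f (g z • resolvent x z) = _
  rw [map_smul, algHom_resolvent f (hx hz), smul_eq_mul, smul_eq_mul, mul_comm]

theorem algHom_dunford_of_mem_ball (f : A →ₐ[ℂ] ℂ)
    (hg : DifferentiableOn ℂ g (Metric.closedBall c R))
    (hx : Metric.sphere c R ⊆ resolventSet ℂ x) (hf : f x ∈ Metric.ball c R) :
    f (dunford x g c R) = g (f x) := by
  rw [algHom_dunford f (Metric.pos_of_mem_ball hf).le
    (hg.continuousOn.mono Metric.sphere_subset_closedBall) hx]
  exact (hg.mono Metric.closure_ball_subset_closedBall).diffContOnCl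
    |>.two_pi_i_inv_smul_circleIntegral_sub_inv_smul hf

theorem algHom_dunford_of_notMem_closedBall (f : A →ₐ[ℂ] ℂ) (hR : 0 ≤ R)
    (hg : DifferentiableOn ℂ g (Metric.closedBall c R))
    (hx : Metric.sphere c R ⊆ resolventSet ℂ x) (hf : f x ∉ Metric.closedBall c R) :
    f (dunford x g c R) = 0 := by
  have hd : DifferentiableOn ℂ (fun z => (z - f x)⁻¹ • g z) (Metric.closedBall c R) :=
    ((differentiableOn_id.sub_const (f x)).fun_inv fun z hz hz0 =>
      hf (sub_eq_zero.1 hz0 ▸ hz)).smul hg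
  rw [algHom_dunford f hR (hg.continuousOn.mono Metric.sphere_subset_closedBall) hx,
    (hd.mono Metric.closure_ball_subset_closedBall).diffContOnCl.circleIntegral_eq_zero hR,
    smul_zero]

end Dunford

section NonUnital

variable {C : Type*} [NonUnitalNormedCommRing C] [NormedSpace ℂ C] [IsScalarTower ℂ C C]
  [SMulCommClass ℂ C C] [CompleteSpace C]

theorem exists_algHom_eq_of_mem_spectrum {a : Unitization ℂ C} {z : ℂ}
    (hz : z ∈ spectrum ℂ (WithLp.toLp 1 a)) : ∃ f : Unitization ℂ C →ₐ[ℂ] ℂ, f a = z := by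
  let e := WithLp.unitizationAlgEquiv (𝕜 := ℂ) (A := C) ℂ
  let _ : NormedCommRing (WithLp 1 (Unitization ℂ C)) :=
    { WithLp.instUnitizationNormedRing (𝕜 := ℂ) (A := C) with
      mul_comm := fun x y => e.injective (by rw [map_mul, map_mul, mul_comm]) }
  obtain ⟨f, hf⟩ := WeakDual.CharacterSpace.mem_spectrum_iff_exists.1 hz
  exact ⟨(WeakDual.CharacterSpace.toAlgHom f).comp e.symm.toAlgHom, hf⟩

theorem exists_forall_character_eq {c : ℂ} {R : ℝ} (hR : 0 < R)
    (h0 : (0 : ℂ) ∉ Metric.closedBall c R) {g : ℂ → ℂ}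
    (hg : DifferentiableOn ℂ g (Metric.closedBall c R)) {a : C}
    (ha : ∀ χ : C →ₙₐ[ℂ] ℂ, χ a = 0 ∨ χ a ∈ Metric.ball c R) :
    ∃ v : C, ∀ χ : C →ₙₐ[ℂ] ℂ, χ a ∈ Metric.ball c R → χ v = g (χ a) := by
  let e := WithLp.unitizationAlgEquiv (𝕜 := ℂ) (A := C) ℂ
  let x : WithLp 1 (Unitization ℂ C) := WithLp.toLp 1 (a : Unitization ℂ C)
  have hx : Metric.sphere c R ⊆ resolventSet ℂ x := by
    intro z hz
    by_contra hzx
    obtain ⟨f, rfl⟩ := exists_algHom_eq_of_mem_spectrum hzx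
    rcases ha (Unitization.lift.symm f) with h | h <;> rw [Unitization.lift_symm_apply_apply] at h
    · exact h0 (h ▸ Metric.sphere_subset_closedBall hz)
    · exact (Metric.mem_ball.1 h).ne hz
  let v := e (dunford x g c R)
  -- The circle does not enclose `0`, so the scalar part of the integral vanishes.
  have hv : ((v.snd : C) : Unitization ℂ C) = v := by
    have h : v.fst = 0 := algHom_dunford_of_notMem_closedBall
      ((Unitization.fstHom ℂ C).comp e.toAlgHom) hR.le hg hx h0
    exact Unitization.ext h.symm rfl
  refine ⟨v.snd, fun χ hχ => ?_⟩
  have hlift (b : C) : Unitization.lift χ (b : Unitization ℂ C) = χ b := by simp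
  rw [← hlift a] at hχ
  rw [← hlift v.snd, hv, ← hlift a]
  exact algHom_dunford_of_mem_ball ((Unitization.lift χ).comp e.toAlgHom) hg hx hχ

end NonUnital

theorem IsExp.map {Q Q' : Type*} [Mul Q] [AddCommMonoid Q] [Module ℂ Q] [TopologicalSpace Q]
    [Mul Q'] [AddCommMonoid Q'] [Module ℂ Q'] [TopologicalSpace Q'] (L : Q →L[ℂ] Q')
    (hL : ∀ a b, L (a * b) = L a * L b) {e v w : Q} (h : IsExp e v w) :
    IsExp (L e) (L v) (L w) := by
  refine (h.mapL L).congr_fun fun n => ?_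
  rw [map_smul, Function.Semiconj.iterate_right (fun x => hL v x) n e]

theorem isExp_iff_eq_exp_mul {e v w : ℂ} : IsExp e v w ↔ w = Complex.exp v * e := by
  have h : IsExp e v (Complex.exp v * e) := by
    rw [Complex.exp_eq_exp_ℂ]
    refine ((NormedSpace.expSeries_div_hasSum_exp v).mul_right e).congr_fun fun n => ?_
    rw [mul_left_iterate, smul_eq_mul]
    ring
  exact ⟨fun hw => hw.unique h, fun hw => hw ▸ h⟩

theorem exists_isExp {C : Type*} [NonUnitalNormedRing C] [NormedSpace ℂ C] [IsScalarTower ℂ C C]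
    [SMulCommClass ℂ C C] [CompleteSpace C] (e v : C) : ∃ w, IsExp e v w := by
  let L : C →L[ℂ] C := ContinuousLinearMap.mul ℂ C v
  refine ⟨NormedSpace.exp L e, ?_⟩
  refine ((NormedSpace.exp_series_hasSum_exp' (𝕂 := ℂ) L).mapL
    (ContinuousLinearMap.apply ℂ C e)).congr_fun fun n => ?_
  simp only [map_smul, ContinuousLinearMap.apply_apply, FunLike.coe_pow_eq_iterate]
  rfl

section Radical

variable {C : Type*} [NonUnitalNormedCommRing C] [NormedSpace ℂ C] [IsScalarTower ℂ C C]
  [SMulCommClass ℂ C C] [CompleteSpace C]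

theorem isExp_modRad {e v w : C} (h : ∀ χ : C →ₙₐ[ℂ] ℂ, χ w = Complex.exp (χ v) * χ e) :
    IsExp (modRad e) (modRad v) (modRad w) := by
  obtain ⟨w', hw'⟩ := exists_isExp e v
  have hww' : modRad w = modRad w' := modRad_eq_iff.2 fun χ =>
    (h χ).trans (isExp_iff_eq_exp_mul.1 (hw'.map (characterCLM χ) (map_mul χ))).symm
  rw [hww']
  exact hw'.map (radical C).mkQL modRad_mul

end Radical

section AsymptoticCone

theorem mem_asymptoticCone_iff_frequently_smul {V : Type*} [AddCommGroup V] [Module ℝ V]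
    [TopologicalSpace V] [IsTopologicalAddGroup V] [ContinuousSMul ℝ V] {S : Set V} {v : V} :
    v ∈ asymptoticCone ℝ S ↔ ∃ᶠ p in Filter.atTop (α := ℝ) ×ˢ nhds v, p.1 • p.2 ∈ S := by
  rw [mem_asymptoticCone_iff, AffineSpace.asymptoticNhds_eq_smul, ← Filter.map₂_smul,
    ← Filter.map_prod_eq_map₂, Filter.frequently_map]

theorem enorm_le_of_mem_asymptoticCone {γ t₀ : ℝ} {S : Set ℂ} {F : ℂ → ℂ} {m : ℝ≥0∞} {v s : ℂ}
    (hF : Continuous F) (ht₀ : 0 < t₀)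
    (hm : ∀ c ∈ S, ∀ t ∈ sector γ, ‖t‖ ≤ t₀ → ‖F (c * t)‖ₑ ≤ m) (hv : v ∈ asymptoticCone ℝ S)
    (hs : s ∈ sector γ) : ‖F (v * s)‖ₑ ≤ m := by
  have hlim : Filter.Tendsto (fun p : ℝ × ℂ => ‖F (p.2 * s)‖ₑ) (Filter.atTop ×ˢ nhds v)
      (nhds ‖F (v * s)‖ₑ) :=
    ((hF.comp (continuous_mul_const s)).enorm.tendsto v).comp Filter.tendsto_snd
  refine le_of_tendsto_of_frequently hlim ?_
  have hsmall : ∀ᶠ r : ℝ in Filter.atTop, r⁻¹ * ‖s‖ ≤ t₀ := by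
    have h : Filter.Tendsto (fun r : ℝ => r⁻¹ * ‖s‖) Filter.atTop (nhds 0) := by
      simpa only [zero_mul] using tendsto_inv_atTop_zero.mul_const ‖s‖
    exact h.eventually_le_const ht₀
  refine ((mem_asymptoticCone_iff_frequently_smul.1 hv).and_eventually
    ((hsmall.and (Filter.eventually_gt_atTop 0)).prod_inl _)).mono ?_
  rintro ⟨r, w⟩ ⟨hw, hrs, hr⟩
  have hws : w * s = r • w * ((r⁻¹ : ℝ) * s) := by
    have hr' : (r : ℂ) ≠ 0 := Complex.ofReal_ne_zero.2 hr.ne'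
    rw [Complex.real_smul, Complex.ofReal_inv]
    field_simp
  simp only [hws]
  refine hm _ hw _ (real_mul_mem_sector (inv_pos.2 hr) hs) ?_
  rwa [norm_mul, Complex.norm_of_nonneg (inv_pos.2 hr).le]

end AsymptoticCone

namespace AnalyticSemigroup

variable {α : ℝ} {B : Type*} [NonUnitalNormedRing B] [NormedSpace ℂ B] [IsScalarTower ℂ B B]
  [SMulCommClass ℂ B B] (T : AnalyticSemigroup α B)

/-- The exponents of the characters of the algebra of the semigroup: the numbers `c` for which some
character takes `T(t)` to `e^{ct}`. -/
def exponents : Set ℂ :=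
  {c | ∃ χ : T.algebra →ₙₐ[ℂ] ℂ, ∀ t : sector α, χ (T.elem t) = Complex.exp (c * t)}

/-- The inclusion of the algebra of the semigroup as a continuous linear map. -/
def inclusion : T.algebra →L[ℂ] B where
  toLinearMap := (NonUnitalSubalgebraClass.subtype T.algebra : T.algebra →ₗ[ℂ] B)
  cont := continuous_subtype_val

theorem exists_strongDual_extension (L : T.algebra →L[ℂ] ℂ) :
    ∃ F : StrongDual ℂ B, ∀ a : T.algebra, F a = L a :=
  let ⟨F, hF, _⟩ := exists_extension_norm_eq T.algebra.toSubmodule L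
  ⟨F, hF⟩

theorem exists_integrable_eq_elem {β : ℝ} (hα : α ≤ Real.pi / 2) {μ : ComplexMeasure (sector α)}
    (hμc : HasCompactSupp μ) (hμβ : CarriedBy μ {ξ | |(ξ : ℂ).arg| ≤ β}) {t : ℂ}
    (ht : t ∈ sector (α - β)) :
    ∃ g : sector α → T.algebra, Integrable g (jordanVariation μ) ∧
      ∀ᵐ ξ : sector α ∂jordanVariation μ, ∃ h : t * ξ ∈ sector α, g ξ = T.elem ⟨t * ξ, h⟩ := by
  classical
  obtain ⟨K, hK, hμK⟩ := hμc.exists_ae_mem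
  have hclosed : IsClosed {ξ : sector α | |(ξ : ℂ).arg| ≤ β} :=
    isClosed_le continuous_arg_sector.abs continuous_const
  have hmem {ξ : sector α} (hξ : |(ξ : ℂ).arg| ≤ β) : t * ξ ∈ sector α :=
    mul_mem_sector hα ht (ne_zero_of_mem_sector ξ.2) hξ
  let g (ξ : sector α) : T.algebra := if h : t * ξ ∈ sector α then T.elem ⟨t * ξ, h⟩ else 0
  have hg : ContinuousOn g (K ∩ {ξ | |(ξ : ℂ).arg| ≤ β}) := by
    rw [Topology.IsInducing.subtypeVal.continuousOn_iff]
    refine (T.differentiableOn.continuousOn.comp (f := fun ξ : sector α => t * (ξ : ℂ))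
      (by fun_prop) fun ξ hξ => hmem hξ.2).congr fun ξ hξ => ?_
    exact congrArg Subtype.val (dif_pos (hmem hξ.2))
  have hμβ' := hμβ.ae_mem hclosed.measurableSet
  exact ⟨g, integrable_of_continuousOn_of_ae_mem (hK.inter_right hclosed) (hμK.and hμβ') hg,
    hμβ'.mono fun ξ hξ => ⟨hmem hξ, dif_pos (hmem hξ)⟩⟩

variable {T} in
theorem elem_add (s t : sector α) (h : (s + t : ℂ) ∈ sector α) :
    T.elem ⟨s + t, h⟩ = T.elem s * T.elem t :=
  Subtype.ext (T.map_add s s.2 t t.2)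

variable [CompleteSpace B]

variable {T} in
theorem character_ext {χ ψ : T.algebra →ₙₐ[ℂ] ℂ} (h : ∀ t, χ (T.elem t) = ψ (T.elem t)) :
    χ = ψ := by
  let S : NonUnitalSubalgebra ℂ B :=
    (NonUnitalAlgHom.equalizer χ ψ).map (NonUnitalSubalgebraClass.subtype T.algebra)
  have hS : IsClosed (S : Set B) :=
    (NonUnitalSubalgebra.isClosed_topologicalClosure _).isClosedEmbedding_subtypeVal.isClosedMap _
      (isClosed_eq (characterCLM χ).continuous (characterCLM ψ).continuous)
  have hle : T.algebra ≤ S := by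
    refine NonUnitalSubalgebra.topologicalClosure_minimal (NonUnitalAlgebra.adjoin_le ?_) hS
    rintro _ ⟨t, ht, rfl⟩
    exact ⟨T.elem ⟨t, ht⟩, h ⟨t, ht⟩, rfl⟩
  ext a
  obtain ⟨b, hb, hba⟩ := hle a.2
  rwa [← show b = a from Subtype.ext hba]

theorem character_eq_zero_or_exists_exponent (hα : α ≤ Real.pi / 2) (χ : T.algebra →ₙₐ[ℂ] ℂ) :
    χ = 0 ∨ ∃ c, ∀ t : sector α, χ (T.elem t) = Complex.exp (c * t) := by
  obtain ⟨F, hF⟩ := T.exists_strongDual_extension (characterCLM χ)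
  have hFT (t : ℂ) (ht : t ∈ sector α) : F (T.toFun t) = χ (T.elem ⟨t, ht⟩) := hF (T.elem ⟨t, ht⟩)
  have hadd (s : ℂ) (hs : s ∈ sector α) (t : ℂ) (ht : t ∈ sector α) : s + t ∈ sector α :=
    add_mem_sector hα hs ht
  refine (eqOn_zero_or_exists_eqOn_exp (isOpen_sector α) (convex_sector hα).isPreconnected hadd
    (F.differentiable.comp_differentiableOn T.differentiableOn) fun s hs t ht => ?_).imp
    (fun h => ?_) fun ⟨c, hc⟩ => ?_
  · simp only [Function.comp_apply, hFT _ hs, hFT _ ht, hFT _ (hadd s hs t ht), ← map_mul]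
    exact congrArg χ (elem_add ⟨s, hs⟩ ⟨t, ht⟩ _)
  · exact character_ext fun t => (hFT t t.2).symm.trans (h t.2)
  · exact ⟨c, fun t => (hFT t t.2).symm.trans (hc t.2)⟩

variable {T} {c : ℂ}

theorem re_mul_le_norm_of_mem_exponents (hc : c ∈ T.exponents) (t : sector α) :
    (c * t).re ≤ ‖T.elem t‖ := by
  obtain ⟨χ, hχ⟩ := hc
  calc (c * t).re ≤ Real.exp (c * t).re := by linarith [Real.add_one_le_exp (c * t).re]
    _ = ‖χ (T.elem t)‖ := by rw [hχ, Complex.norm_exp]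
    _ ≤ ‖T.elem t‖ := norm_character_le χ _

theorem enorm_laplace_le_rho_calculus {β : ℝ} (hα : α ≤ Real.pi / 2)
    {μ : ComplexMeasure (sector α)} (hμc : HasCompactSupp μ)
    (hμβ : CarriedBy μ {ξ | |(ξ : ℂ).arg| ≤ β}) {t : ℂ} (ht : t ∈ sector (α - β))
    (hc : c ∈ T.exponents) : ‖laplace μ (-c * t)‖ₑ ≤ rho (T.calculus μ t) := by
  obtain ⟨χ, hχ⟩ := hc
  obtain ⟨g, hg, hgT⟩ := T.exists_integrable_eq_elem hα hμc hμβ ht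
  have hcalculus : T.calculus μ t = T.inclusion (cintegral μ g) := by
    rw [← cintegral_comp_comm T.inclusion hg]
    exact cintegral_congr_ae (hgT.mono fun ξ ⟨_, hξ⟩ => (congrArg T.inclusion hξ).symm)
  have hlaplace : laplace μ (-c * t) = χ (cintegral μ g) := by
    rw [← characterCLM_apply, ← cintegral_comp_comm (characterCLM χ) hg]
    refine cintegral_congr_ae (hgT.mono fun ξ ⟨_, hξ⟩ => ?_)
    simp only [hξ, characterCLM_apply, hχ, neg_mul, neg_neg, mul_assoc]
  rw [hcalculus, hlaplace]
  exact (enorm_character_le_rho χ _).trans_eq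
    (rho_map_of_norm_map (NonUnitalSubalgebraClass.subtype T.algebra) (fun _ => rfl) _).symm

theorem re_mul_nonpos_of_mem_asymptoticCone {v : ℂ} (hv : v ∈ asymptoticCone ℝ T.exponents)
    {s : ℂ} (hs : s ∈ sector α) : (v * s).re ≤ 0 := by
  have hlim : Filter.Tendsto (fun p : ℝ × ℂ => (p.2 * s).re - p.1⁻¹ * ‖T.elem ⟨s, hs⟩‖)
      (Filter.atTop ×ˢ nhds v) (nhds ((v * s).re - 0 * ‖T.elem ⟨s, hs⟩‖)) :=
    (((Complex.continuous_re.comp (continuous_mul_const s)).tendsto v).comp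
      Filter.tendsto_snd).sub ((tendsto_inv_atTop_zero.comp Filter.tendsto_fst).mul_const _)
  rw [zero_mul, sub_zero] at hlim
  refine le_of_tendsto_of_frequently hlim ?_
  refine ((mem_asymptoticCone_iff_frequently_smul.1 hv).and_eventually
    ((Filter.eventually_gt_atTop 0).prod_inl _)).mono ?_
  rintro ⟨r, w⟩ ⟨hw, hr⟩
  have h : r * (w * s).re ≤ ‖T.elem ⟨s, hs⟩‖ := by
    simpa only [Complex.real_smul, mul_assoc, Complex.re_ofReal_mul] using
      re_mul_le_norm_of_mem_exponents hw ⟨s, hs⟩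
  rw [sub_nonpos, inv_mul_eq_div, le_div_iff₀' hr]
  exact h

variable (T) in
theorem exists_forall_character_elem_eq (h0 : 0 < α) (hα : α ≤ Real.pi / 2)
    (hT : Bornology.IsBounded T.exponents) :
    ∃ e u : T.algebra, ∀ χ : T.algebra →ₙₐ[ℂ] ℂ,
      χ = 0 ∨ χ e = 1 ∧ ∀ t : sector α, χ (T.elem t) = Complex.exp (t * χ u) := by
  obtain ⟨r, hr, hrT⟩ : ∃ r : ℝ, 0 < r ∧ ∀ c ∈ T.exponents, ‖c * r‖ ≤ 1 / 8 := by
    obtain ⟨R, hR, hRT⟩ := hT.exists_pos_norm_le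
    refine ⟨(8 * R)⁻¹, by positivity, fun c hc => ?_⟩
    rw [norm_mul, Complex.norm_of_nonneg (by positivity), ← div_eq_mul_inv,
      div_le_iff₀ (by positivity)]
    linarith [hRT c hc]
  let a := T.elem ⟨r, ofReal_mem_sector h0 hr⟩
  have hball {c : ℂ} (hc : c ∈ T.exponents) : Complex.exp (c * r) ∈ Metric.ball 1 (1 / 2) := by
    rw [mem_ball_iff_norm]
    linarith [hrT c hc, Complex.norm_exp_sub_one_le ((hrT c hc).trans (by norm_num))]
  have ha (χ : T.algebra →ₙₐ[ℂ] ℂ) : χ a = 0 ∨ χ a ∈ Metric.ball 1 (1 / 2) := by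
    refine (T.character_eq_zero_or_exists_exponent hα χ).imp (fun h => ?_) fun ⟨c, hc⟩ => ?_
    · rw [h, NonUnitalAlgHom.zero_apply]
    · exact (hc _).symm ▸ hball ⟨χ, hc⟩
  have hslit : Metric.closedBall (1 : ℂ) (1 / 2) ⊆ Complex.slitPlane :=
    (Metric.closedBall_subset_ball (by norm_num)).trans Complex.ball_one_subset_slitPlane
  have h0mem : (0 : ℂ) ∉ Metric.closedBall (1 : ℂ) (1 / 2) := fun h =>
    Complex.zero_notMem_slitPlane (hslit h)
  obtain ⟨e, he⟩ := exists_forall_character_eq (by norm_num) h0mem (differentiableOn_const 1) ha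
  obtain ⟨u, hu⟩ := exists_forall_character_eq (g := fun z => Complex.log z / r) (by norm_num)
    h0mem ((differentiableOn_id.clog hslit).div_const _) ha
  refine ⟨e, u, fun χ => (T.character_eq_zero_or_exists_exponent hα χ).imp_right ?_⟩
  rintro ⟨c, hc⟩
  have hχa : χ a = Complex.exp (c * r) := hc _
  have hχ : χ a ∈ Metric.ball 1 (1 / 2) := hχa ▸ hball ⟨χ, hc⟩
  have hχu : χ u = c := by
    have him := abs_le.1 ((Complex.abs_im_le_norm (c * r)).trans (hrT c ⟨χ, hc⟩))
    rw [hu χ hχ, hχa, Complex.log_exp (by linarith [Real.pi_gt_three])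
      (by linarith [Real.pi_gt_three]), mul_div_cancel_right₀ _ (Complex.ofReal_ne_zero.2 hr.ne')]
  exact ⟨he χ hχ, fun t => by rw [hc, hχu, mul_comm]⟩

variable (T) in
theorem exists_isUnitElement_isExp (h0 : 0 < α) (hα : α ≤ Real.pi / 2)
    (hT : Bornology.IsBounded T.exponents) :
    ∃ e : ModRadical T.algebra, IsUnitElement e ∧
      ∃ u : ModRadical T.algebra, ∀ t : sector α, IsExp e ((t : ℂ) • u) (modRad (T.elem t)) := by
  obtain ⟨e, u, heu⟩ := T.exists_forall_character_elem_eq h0 hα hT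
  refine ⟨modRad e, isUnitElement_modRad fun χ a => ?_, modRad u, fun t =>
    isExp_modRad (v := (t : ℂ) • u) fun χ => ?_⟩
  · exact (heu χ).imp (fun h => by rw [h, NonUnitalAlgHom.zero_apply]) And.left
  · rcases heu χ with rfl | ⟨he, hu⟩
    · simp only [NonUnitalAlgHom.zero_apply, mul_zero]
    · rw [hu, he, map_smul, smul_eq_mul, mul_one]

theorem enorm_laplace_le_of_not_isBounded {β : ℝ} (hα : α ≤ Real.pi / 2) (hβ : 0 ≤ β)
    (hβα : β < α) {μ : ComplexMeasure (sector α)}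
    (hμc : HasCompactSupp μ) (hμβ : CarriedBy μ {ξ | |(ξ : ℂ).arg| ≤ β})
    (hμs : IsSymmetricMeasure μ)
    (hT : ¬ Bornology.IsBounded T.exponents) {t₀ : ℝ} (ht₀ : 0 < t₀) {m : ℝ≥0∞}
    (hm : ∀ t ∈ sector (α - β), ‖t‖ ≤ t₀ → rho (T.calculus μ t) ≤ m) {z : ℂ}
    (hz : z ∈ sector (α - β)) : ‖laplace μ z‖ₑ ≤ m := by
  rcases eq_or_ne m ⊤ with rfl | hmtop
  · exact le_top
  lift m to ℝ≥0 using hmtop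
  have hf : Differentiable ℂ (laplace μ) := hμc.differentiable_laplace
  obtain ⟨v, hv0, hv⟩ := not_bounded_iff_exists_ne_zero_mem_asymptoticCone.1 hT
  have hdual : |(-v).arg| ≤ Real.pi / 2 - α :=
    abs_arg_le_of_forall_re_mul_nonneg (hβ.trans_lt hβα) hα fun s hs => by
      rw [neg_mul, Complex.neg_re, neg_nonneg]
      exact re_mul_nonpos_of_mem_asymptoticCone hv hs
  have hrotated (s : ℂ) (hs : s ∈ sector (α - β)) : ‖laplace μ (-v * s)‖ₑ ≤ m := by
    rw [neg_mul]
    refine enorm_le_of_mem_asymptoticCone (F := fun z => laplace μ (-z))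
      (hf.continuous.comp continuous_neg) ht₀ (fun c hc t ht htn => ?_) hv hs
    rw [← neg_mul]
    exact (enorm_laplace_le_rho_calculus hα hμc hμβ ht hc).trans (hm t ht htn)
  have hconj (z : ℂ) : ‖laplace μ (conj z)‖ = ‖laplace μ z‖ := by
    rw [hμs.laplace_conj, Complex.norm_conj]
  have hbound := norm_le_on_sector_of_norm_le_on_rotated hf hconj (by linarith)
    (fun w hw => norm_laplace_le μ hw) (by linarith) (neg_ne_zero.2 hv0) hdual
    (fun s hs => enorm_le_coe.1 (hrotated s hs)) z hz
  exact enorm_le_coe.2 hbound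

end AnalyticSemigroup

theorem theorem3p4_general {B : Type*} [NonUnitalNormedRing B] [NormedSpace ℂ B]
    [IsScalarTower ℂ B B] [SMulCommClass ℂ B B] [CompleteSpace B] {α β : ℝ}
    (hα : α ≤ Real.pi / 2) (hβ : 0 ≤ β) (hβα : β < α) {μ : ComplexMeasure (sector α)}
    (hμc : HasCompactSupp μ) (hμβ : CarriedBy μ {ξ | |(ξ : ℂ).arg| ≤ β})
    (hμs : IsSymmetricMeasure μ) (T : AnalyticSemigroup α B) {t₀ : ℝ} (ht₀ : 0 < t₀)
    (hlt : ⨆ t ∈ {t : ℂ | t ∈ sector (α - β) ∧ ‖t‖ ≤ t₀}, rho (T.calculus μ t)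
      < ⨆ z ∈ sector (α - β), ‖laplace μ z‖ₑ) :
    ∃ e : ModRadical T.algebra, IsUnitElement e ∧
      ∃ u : ModRadical T.algebra, ∀ t : sector α, IsExp e ((t : ℂ) • u) (modRad (T.elem t)) := by
  refine T.exists_isUnitElement_isExp (hβ.trans_lt hβα) hα ?_
  by_contra hT
  refine hlt.not_ge (iSup₂_le fun z hz => ?_)
  exact AnalyticSemigroup.enorm_laplace_le_of_not_isBounded hα hβ hβα hμc hμβ hμs hT ht₀
    (fun t ht htn => le_iSup₂_of_le t ⟨ht, htn⟩ le_rfl) hz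

end

theorem theorem3p4 {B : Type*} [NonUnitalNormedRing B] [NormedSpace ℂ B] [IsScalarTower ℂ B B]
    [SMulCommClass ℂ B B] [CompleteSpace B]
    (α β : ℝ) (hα : α < Real.pi / 2) (hβ : 0 ≤ β) (hβα : β < α)
    (φ : holomorphicOnSector α →L[ℂ] ℂ) (μ : ComplexMeasure (sector α))
    (hφ : IsInducedBy φ μ) (hμc : HasCompactSupp μ) (hμβ : CarriedBy μ {ξ | |(ξ : ℂ).arg| ≤ β})
    (hμs : IsSymmetricMeasure μ) (hμ0 : μ Set.univ = 0)
    (T : AnalyticSemigroup α B) (hT : ¬ T.IsQuasinilpotent)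
    (t₀ : ℝ) (ht₀ : 0 < t₀)
    (hlt : ⨆ t ∈ {t : ℂ | t ∈ sector (α - β) ∧ ‖t‖ ≤ t₀}, rho (T.calculus μ t)
      < ⨆ z ∈ sector (α - β), (‖fourierBorel φ z‖₊ : ℝ≥0∞)) :
    ∃ e : ModRadical T.algebra, IsUnitElement e ∧
      ∃ u : ModRadical T.algebra, ∀ t : sector α, IsExp e ((t : ℂ) • u) (modRad (T.elem t)) := by
  exact theorem3p4_general hα.le hβ hβα hμc hμβ hμs T ht₀
    (by simpa only [hφ.fourierBorel_eq, enorm_eq_nnnorm] using hlt)
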